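/- Let $T\in(0,\infty)$ and let $(\Omega,\mathcal F,\mathbb P)$ be a complete probability space carrying two independent standard one-dimensional Brownian motions $W,\overline W$ and, independent of $(W,\overline W)$, a càdlàg homogeneous continuous-time Markov chain $\alpha$ on $\mathcal S=\{1,\dots,D\}$ with $\alpha(0)=i$ and generator $\Lambda=(\lambda_{jk})$, where $\lambda_{jk}>0$ for $j\ne k$ and $\sum_k\lambda_{jk}=0$. Let $\mathbb F$ and $\mathbb G$ be the filtrations generated by $(W,\overline W,\alpha)$ and by $(W,\alpha)$, respectively, augmented by the $\mathbb P$-null sets. For $\mathbb H=\mathbb F,\mathbb G$ let $L^2_{\mathbb H}(0,T;\mathbb R^k)$ be the set of $\mathbb H$-progressively measurable $\mathbb R^k$-valued processes $\varphi$ with $\mathbb E\int_0^T|\varphi(s)|^2ds<\infty$. For $u\in L^2_{\mathbb G}(0,T;\mathbb R^m)$ and $v\in L^2_{\mathbb F}(0,T;\mathbb R^{n_v})$ let $x^0$ be the strong solution in $L^2_{\mathbb F}(\Omega;C([0,T];\mathbb R^n))$ of the homogeneous equation, with all coefficients evaluated at $(s,\alpha(s))$, $$dx^0=[Ax^0+B_1u+B_2v]\,ds+[Cx^0+D_1u+D_2v]\,dW+[\bar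 Cx^0+\bar D_1u+\bar D_2v]\,d\overline W,\qquad x^0(0)=0,$$ and for $\gamma>0$ let $$J^0_\gamma(0,0,i;u,v)=\mathbb E\Big\{\langle G(T,\alpha(T))x^0(T),x^0(T)\rangle+\int_0^T\big[\langle Qx^0,x^0\rangle+\langle R_1u,u\rangle+\langle (R_2-\gamma^2I)v,v\rangle+2\langle S_1x^0,u\rangle+2\langle S_2x^0,v\rangle\big]ds\Big\},$$ $$\overline V^0_\gamma(0,0,i)=\inf_{u\in L^2_{\mathbb G}(0,T;\mathbb R^m)}\ \sup_{v\in L^2_{\mathbb F}(0,T;\mathbb R^{n_v})}J^0_\gamma(0,0,i;u,v)\in[-\infty,\infty].$$ These are the state equation, cost and open-loop upper value of the homogeneous problem, obtained from the general problem by setting to zero the inhomogeneous terms $b,\sigma,\bar\sigma$ of the state equation, the linear weights $q,\rho_1,\rho_2$ of the running cost and the linear weight $g(T,\cdot)$ of the terminal cost. Write $R=\mathrm{diag}(R_1,R_2)$ and let $S$ be $S_1$ stacked on $S_2$. All coefficients are deterministic, and the following is assumed for every $j\in\mathcal S$. (H1) $A(\cdot,j),b(\cdot,j)\in L^1(0,T)$;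 $B_1(\cdot,j),B_2(\cdot,j),C(\cdot,j),\bar C(\cdot,j),\sigma(\cdot,j),\bar\sigma(\cdot,j)\in L^2(0,T)$; $D_1(\cdot,j),D_2(\cdot,j),\bar D_1(\cdot,j),\bar D_2(\cdot,j)\in L^\infty(0,T)$. (H2) $Q(\cdot,j),q(\cdot,j)\in L^1(0,T)$; $S_1(\cdot,j),S_2(\cdot,j),\rho_1(\cdot,j),\rho_2(\cdot,j)\in L^2(0,T)$; $R_1(\cdot,j),R_2(\cdot,j)\in L^\infty(0,T)$; and $Q(s,j),R(s,j)$ (a.e. $s$), $G(T,j)$ are symmetric. (H3) $G(T,j)\ge0$; there is $\delta>0$ with $R(s,j)\ge\delta I$ for a.e. $s\in[0,T]$; and $Q(s,j)-S(s,j)^\top R(s,j)^{-1}S(s,j)\ge0$ for a.e. $s\in[0,T]$. **Proposition 3.1.** Under (H1)–(H3), if $0<\gamma_1\le\gamma_2$, then $\overline V^0_{\gamma_2}(0,0,i)\le\overline V^0_{\gamma_1}(0,0,i)$. -/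

import Mathlib

open MeasureTheory ProbabilityTheory Filter
open scoped NNReal ENNReal Topology

noncomputable section

namespace SLQGame

/-- `ℝᵏ` with its Euclidean norm and inner product. -/
abbrev Vec (k : ℕ) := EuclideanSpace ℝ (Fin k)

/-- Lebesgue measure on the time interval `[0, t]`, as a measure on `ℝ≥0`. -/
def lebesgue (t : ℝ≥0) : Measure ℝ≥0 :=
  (volume.restrict (Set.Icc (0 : ℝ) t)).map Real.toNNReal

/-! ### The Markov chain, the noise and the two filtrations -/

section Noise

variable {Ω : Type*} [mΩ : MeasurableSpace Ω]

/-- `Λ` is the generator of a chain on `{1, …, D}`: its rows sum to `0`, and all off-diagonal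
transition intensities are strictly positive (so the chain is irreducible). -/
structure IsGenerator {D : ℕ} (Λ : Matrix (Fin D) (Fin D) ℝ) : Prop where
  pos : ∀ i j, i ≠ j → 0 < Λ i j
  row_sum : ∀ i, ∑ j, Λ i j = 0

/-- `α` is, under `P`, a homogeneous continuous-time Markov chain with generator `Λ` that starts
from the state `i` and has càdlàg paths. Its transition probabilities are the entries of
`exp (h Λ)`, and the Markov property is with respect to the past `σ(α(r) : r ≤ s)`. -/
structure IsMarkovChain {D : ℕ} (P : Measure Ω) (Λ : Matrix (Fin D) (Fin D) ℝ) (i : Fin D)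
    (α : ℝ≥0 → Ω → Fin D) : Prop where
  generator : IsGenerator Λ
  measurable : ∀ t, Measurable (α t)
  initial : ∀ᵐ ω ∂P, α 0 ω = i
  cadlag : ∀ᵐ ω ∂P, ∀ t, ContinuousWithinAt (fun s => α s ω) (Set.Ici t) t ∧
    ∃ l, Tendsto (fun s => α s ω) (𝓝[<] t) (𝓝 l)
  markov : ∀ (s h : ℝ≥0) (j k : Fin D) (A : Set Ω),
    MeasurableSet[⨆ r ≤ s, MeasurableSpace.comap (α r) inferInstance] A →
      P.real (A ∩ {ω | α s ω = j} ∩ {ω | α (s + h) ω = k})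
        = P.real (A ∩ {ω | α s ω = j}) * NormedSpace.exp ((h : ℝ) • Λ) j k

/-- The random inputs of the model on the probability space `(Ω, P)`: two independent standard
one-dimensional Brownian motions `W`, `W'` and, independent of the pair `(W, W')`, a Markov chain
`α` on `D` states with generator `Λ` and `α(0) = i`. -/
structure Noise {D : ℕ} (P : Measure Ω) (Λ : Matrix (Fin D) (Fin D) ℝ) (i : Fin D) where
  W : ℝ≥0 → Ω → ℝ
  W' : ℝ≥0 → Ω → ℝ
  α : ℝ≥0 → Ω → Fin D
  measurable_W : ∀ t, Measurable (W t)
  measurable_W' : ∀ t, Measurable (W' t)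
  brownian_W : IsBrownianReal W P
  brownian_W' : IsBrownianReal W' P
  chain : IsMarkovChain P Λ i α
  indep_brownian : IndepFun (fun ω t => W t ω) (fun ω t => W' t ω) P
  indep_chain : IndepFun (fun ω => (fun t => W t ω, fun t => W' t ω)) (fun ω t => α t ω) P

/-- The σ-algebra generated by the `P`-null sets. -/
abbrev nullSigma (P : Measure Ω) : MeasurableSpace Ω :=
  MeasurableSpace.generateFrom {A | MeasurableSet A ∧ P A = 0}

theorem nullSigma_le (P : Measure Ω) : nullSigma P ≤ mΩ :=
  MeasurableSpace.generateFrom_le fun _ hA => hA.1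

namespace Noise

variable {D : ℕ} {P : Measure Ω} {Λ : Matrix (Fin D) (Fin D) ℝ} {i : Fin D}

/-- The filtration `𝔽` of complete information: generated by `W`, `W'`, `α`, augmented by the
null sets. -/
def fullInfo (N : Noise P Λ i) : Filtration ℝ≥0 mΩ where
  seq t := (⨆ r ≤ t, MeasurableSpace.comap (N.W r) inferInstance) ⊔
    (⨆ r ≤ t, MeasurableSpace.comap (N.W' r) inferInstance) ⊔
    (⨆ r ≤ t, MeasurableSpace.comap (N.α r) inferInstance) ⊔ nullSigma P
  mono' s t hst := by
    refine sup_le_sup (sup_le_sup (sup_le_sup ?_ ?_) ?_) le_rfl <;>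
      exact biSup_mono fun r hr => hr.trans hst
  le' t := by
    refine sup_le (sup_le (sup_le ?_ ?_) ?_) (nullSigma_le P)
    · exact iSup₂_le fun r _ => (N.measurable_W r).comap_le
    · exact iSup₂_le fun r _ => (N.measurable_W' r).comap_le
    · exact iSup₂_le fun r _ => (N.chain.measurable r).comap_le

/-- The filtration `𝔾` of partial information: generated by `W`, `α` only, augmented by the
null sets. -/
def partialInfo (N : Noise P Λ i) : Filtration ℝ≥0 mΩ where
  seq t := (⨆ r ≤ t, MeasurableSpace.comap (N.W r) inferInstance) ⊔
    (⨆ r ≤ t, MeasurableSpace.comap (N.α r) inferInstance) ⊔ nullSigma P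
  mono' s t hst := by
    refine sup_le_sup (sup_le_sup ?_ ?_) le_rfl <;>
      exact biSup_mono fun r hr => hr.trans hst
  le' t := by
    refine sup_le (sup_le ?_ ?_) (nullSigma_le P)
    · exact iSup₂_le fun r _ => (N.measurable_W r).comap_le
    · exact iSup₂_le fun r _ => (N.chain.measurable r).comap_le

end Noise

/-- `L²_𝓕(0, T; ℝᵏ)`: the `𝓕`-progressively measurable processes `φ` with
`E ∫₀ᵀ |φ(s)|² ds < ∞`. -/
def L2Prog (𝓕 : Filtration ℝ≥0 mΩ) (P : Measure Ω) (T : ℝ≥0) (k : ℕ) :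
    Set (ℝ≥0 → Ω → Vec k) :=
  {φ | IsStronglyProgressive 𝓕 φ ∧ ∫⁻ ω, ∫⁻ s, ‖φ s ω‖ₑ ^ 2 ∂(lebesgue T) ∂P < ∞}

/-! ### The Itô integral -/

/-- Data of a simple process `∑_{l < N} ξ_l 1_{(t_l, t_{l+1}]}` with nondecreasing times and
bounded `𝓕_{t_l}`-measurable coefficients `ξ_l`. -/
structure SimpleProcess (𝓕 : Filtration ℝ≥0 mΩ) (k : ℕ) where
  N : ℕ
  time : ℕ → ℝ≥0
  mono : Monotone time
  coeff : ℕ → Ω → Vec k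
  measurable : ∀ l, StronglyMeasurable[𝓕 (time l)] (coeff l)
  bounded : ∃ c : ℝ, ∀ l ω, ‖coeff l ω‖ ≤ c

/-- The value of a simple process at time `s`. -/
def SimpleProcess.val {𝓕 : Filtration ℝ≥0 mΩ} {k : ℕ} (H : SimpleProcess 𝓕 k)
    (s : ℝ≥0) (ω : Ω) : Vec k :=
  ∑ l ∈ Finset.range H.N,
    (Set.Ioc (H.time l) (H.time (l + 1))).indicator (fun _ => H.coeff l ω) s

/-- The stochastic integral `∫₀ᵗ H dW` of a simple process. -/
def SimpleProcess.integral {𝓕 : Filtration ℝ≥0 mΩ} {k : ℕ} (H : SimpleProcess 𝓕 k)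
    (W : ℝ≥0 → Ω → ℝ) (t : ℝ≥0) (ω : Ω) : Vec k :=
  ∑ l ∈ Finset.range H.N,
    (W (min (H.time (l + 1)) t) ω - W (min (H.time l) t) ω) • H.coeff l ω

/-- `I` is the Itô integral process `I(t) = ∫₀ᵗ φ dW`, `t ∈ [0, T]`: it is adapted and continuous,
and there are simple processes that converge to `φ` in `L²([0, T] × Ω)` and whose integrals up to
time `t` converge to `I(t)` in `L²(Ω)` for every `t ∈ [0, T]`. -/
structure IsItoIntegral (𝓕 : Filtration ℝ≥0 mΩ) (P : Measure Ω) (T : ℝ≥0) {k : ℕ}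
    (W : ℝ≥0 → Ω → ℝ) (φ I : ℝ≥0 → Ω → Vec k) : Prop where
  adapted : StronglyAdapted 𝓕 I
  continuous : ∀ ω, Continuous fun t => I t ω
  approx : ∃ H : ℕ → SimpleProcess 𝓕 k,
    Tendsto (fun r => ∫⁻ p, ‖(H r).val p.1 p.2 - φ p.1 p.2‖ₑ ^ 2 ∂((lebesgue T).prod P))
      atTop (𝓝 0) ∧
    ∀ t ≤ T, Tendsto (fun r => ∫⁻ ω, ‖(H r).integral W t ω - I t ω‖ₑ ^ 2 ∂P) atTop (𝓝 0)

end Noise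

/-! ### Coefficients and the standing assumptions -/

/-- The deterministic coefficients of the state equation (first block; `Cbar`, `Dbar₁`, `Dbar₂`,
`σbar` belong to the second Brownian motion) and of the cost functional (second block), as
functions of time and regime; `G` and `g` are the terminal weights at time `T`. The state, the
control and the disturbance have dimensions `n`, `m` and `d`. -/
structure Coefficients (n m d D : ℕ) where
  A : ℝ≥0 → Fin D → Matrix (Fin n) (Fin n) ℝ
  B₁ : ℝ≥0 → Fin D → Matrix (Fin n) (Fin m) ℝ
  B₂ : ℝ≥0 → Fin D → Matrix (Fin n) (Fin d) ℝ
  b : ℝ≥0 → Fin D → Vec n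
  C : ℝ≥0 → Fin D → Matrix (Fin n) (Fin n) ℝ
  D₁ : ℝ≥0 → Fin D → Matrix (Fin n) (Fin m) ℝ
  D₂ : ℝ≥0 → Fin D → Matrix (Fin n) (Fin d) ℝ
  σ : ℝ≥0 → Fin D → Vec n
  Cbar : ℝ≥0 → Fin D → Matrix (Fin n) (Fin n) ℝ
  Dbar₁ : ℝ≥0 → Fin D → Matrix (Fin n) (Fin m) ℝ
  Dbar₂ : ℝ≥0 → Fin D → Matrix (Fin n) (Fin d) ℝ
  σbar : ℝ≥0 → Fin D → Vec n
  G : Fin D → Matrix (Fin n) (Fin n) ℝ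
  g : Fin D → Vec n
  Q : ℝ≥0 → Fin D → Matrix (Fin n) (Fin n) ℝ
  R₁ : ℝ≥0 → Fin D → Matrix (Fin m) (Fin m) ℝ
  R₂ : ℝ≥0 → Fin D → Matrix (Fin d) (Fin d) ℝ
  S₁ : ℝ≥0 → Fin D → Matrix (Fin m) (Fin n) ℝ
  S₂ : ℝ≥0 → Fin D → Matrix (Fin d) (Fin n) ℝ
  q : ℝ≥0 → Fin D → Vec n
  ρ₁ : ℝ≥0 → Fin D → Vec m
  ρ₂ : ℝ≥0 → Fin D → Vec d

namespace Coefficients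

variable {n m d D : ℕ}

/-- The homogeneous problem: all non-homogeneous terms are set to zero. -/
def homogeneous (c : Coefficients n m d D) : Coefficients n m d D :=
  { c with b := 0, σ := 0, σbar := 0, g := 0, q := 0, ρ₁ := 0, ρ₂ := 0 }

/-- `R = diag(R₁, R₂)`. -/
def R (c : Coefficients n m d D) (s : ℝ≥0) (j : Fin D) : Matrix (Fin m ⊕ Fin d) (Fin m ⊕ Fin d) ℝ :=
  Matrix.fromBlocks (c.R₁ s j) 0 0 (c.R₂ s j)

/-- `S`, the matrix `S₁` stacked on `S₂`. -/
def S (c : Coefficients n m d D) (s : ℝ≥0) (j : Fin D) : Matrix (Fin m ⊕ Fin d) (Fin n) ℝ :=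
  Matrix.fromRows (c.S₁ s j) (c.S₂ s j)

open scoped Matrix.Norms.Frobenius in
/-- (H1): integrability of the coefficients of the state equation on `[0, T]`. -/
structure H1 (c : Coefficients n m d D) (T : ℝ≥0) : Prop where
  A : ∀ j, MemLp (fun s => c.A s j) 1 (lebesgue T)
  B₁ : ∀ j, MemLp (fun s => c.B₁ s j) 2 (lebesgue T)
  B₂ : ∀ j, MemLp (fun s => c.B₂ s j) 2 (lebesgue T)
  b : ∀ j, MemLp (fun s => c.b s j) 1 (lebesgue T)
  C : ∀ j, MemLp (fun s => c.C s j) 2 (lebesgue T)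
  D₁ : ∀ j, MemLp (fun s => c.D₁ s j) ∞ (lebesgue T)
  D₂ : ∀ j, MemLp (fun s => c.D₂ s j) ∞ (lebesgue T)
  σ : ∀ j, MemLp (fun s => c.σ s j) 2 (lebesgue T)
  Cbar : ∀ j, MemLp (fun s => c.Cbar s j) 2 (lebesgue T)
  Dbar₁ : ∀ j, MemLp (fun s => c.Dbar₁ s j) ∞ (lebesgue T)
  Dbar₂ : ∀ j, MemLp (fun s => c.Dbar₂ s j) ∞ (lebesgue T)
  σbar : ∀ j, MemLp (fun s => c.σbar s j) 2 (lebesgue T)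

open scoped Matrix.Norms.Frobenius in
/-- (H2): symmetry and integrability of the weights of the cost functional on `[0, T]`. -/
structure H2 (c : Coefficients n m d D) (T : ℝ≥0) : Prop where
  Q : ∀ j, MemLp (fun s => c.Q s j) 1 (lebesgue T)
  S₁ : ∀ j, MemLp (fun s => c.S₁ s j) 2 (lebesgue T)
  S₂ : ∀ j, MemLp (fun s => c.S₂ s j) 2 (lebesgue T)
  R₁ : ∀ j, MemLp (fun s => c.R₁ s j) ∞ (lebesgue T)
  R₂ : ∀ j, MemLp (fun s => c.R₂ s j) ∞ (lebesgue T)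
  q : ∀ j, MemLp (fun s => c.q s j) 1 (lebesgue T)
  ρ₁ : ∀ j, MemLp (fun s => c.ρ₁ s j) 2 (lebesgue T)
  ρ₂ : ∀ j, MemLp (fun s => c.ρ₂ s j) 2 (lebesgue T)
  symm_G : ∀ j, (c.G j).IsSymm
  symm_Q : ∀ j, ∀ᵐ s ∂(lebesgue T), (c.Q s j).IsSymm
  symm_R : ∀ j, ∀ᵐ s ∂(lebesgue T), (c.R s j).IsSymm

/-- (H3): `G ≥ 0`, `R ≫ 0` (that is, `R ≥ δ I` for some `δ > 0`) and `Q - Sᵀ R⁻¹ S ≥ 0`, for every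
regime and almost every `s ∈ [0, T]`. -/
structure H3 (c : Coefficients n m d D) (T : ℝ≥0) : Prop where
  G : ∀ j, (c.G j).PosSemidef
  R : ∀ j, ∃ δ : ℝ, 0 < δ ∧ ∀ᵐ s ∂(lebesgue T), (c.R s j - δ • 1).PosSemidef
  Q : ∀ j, ∀ᵐ s ∂(lebesgue T),
    (c.Q s j - (c.S s j).transpose * (c.R s j)⁻¹ * c.S s j).PosSemidef

end Coefficients

/-! ### State equation, cost functional and upper value -/

section Game

variable {Ω : Type*} [mΩ : MeasurableSpace Ω] {n m d D : ℕ} {P : Measure Ω}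
  {Λ : Matrix (Fin D) (Fin D) ℝ} {i : Fin D}


/-- `M₀(s,α(s)) x(s) + M₁(s,α(s)) u(s) + M₂(s,α(s)) v(s) + w(s,α(s))`, the common form of the drift
and of the two diffusion terms. -/
def affineTerm (α : ℝ≥0 → Ω → Fin D) (M₀ : ℝ≥0 → Fin D → Matrix (Fin n) (Fin n) ℝ)
    (M₁ : ℝ≥0 → Fin D → Matrix (Fin n) (Fin m) ℝ) (M₂ : ℝ≥0 → Fin D → Matrix (Fin n) (Fin d) ℝ)
    (w : ℝ≥0 → Fin D → Vec n) (x : ℝ≥0 → Ω → Vec n) (u : ℝ≥0 → Ω → Vec m)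
    (v : ℝ≥0 → Ω → Vec d) (s : ℝ≥0) (ω : Ω) : Vec n :=
  (M₀ s (α s ω)).toEuclideanLin (x s ω) + (M₁ s (α s ω)).toEuclideanLin (u s ω) +
    (M₂ s (α s ω)).toEuclideanLin (v s ω) + w s (α s ω)

/-- `x ∈ L²_𝔽(Ω; C([0,T]; ℝⁿ))` is a strong solution on `[0, T]` of the state equation with
initial time `0`, initial state `ξ`, control `u` and disturbance `v`. -/
structure IsStateProcess (N : Noise P Λ i) (c : Coefficients n m d D) (T : ℝ≥0) (ξ : Ω → Vec n)
    (u : ℝ≥0 → Ω → Vec m) (v : ℝ≥0 → Ω → Vec d) (x : ℝ≥0 → Ω → Vec n) : Prop where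
  adapted : StronglyAdapted N.fullInfo x
  continuous : ∀ ω, Continuous fun t => x t ω
  sq_integrable : ∫⁻ ω, ⨆ s ∈ Set.Iic T, ‖x s ω‖ₑ ^ 2 ∂P < ∞
  equation : ∃ I I' : ℝ≥0 → Ω → Vec n,
    IsItoIntegral N.fullInfo P T N.W (affineTerm N.α c.C c.D₁ c.D₂ c.σ x u v) I ∧
    IsItoIntegral N.fullInfo P T N.W' (affineTerm N.α c.Cbar c.Dbar₁ c.Dbar₂ c.σbar x u v) I' ∧
    ∀ᵐ ω ∂P, ∀ t ≤ T, x t ω = ξ ω +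
      ∫ s, affineTerm N.α c.A c.B₁ c.B₂ c.b x u v s ω ∂(lebesgue t) + I t ω + I' t ω

open scoped Classical in
/-- The state process `x(·; 0, ξ, i, u, v)`. Under (H1) the state equation has exactly one strong
solution on `[0, T]` up to indistinguishability for all `u`, `v` in the admissible classes; the
value `0` is used only where there is no solution. -/
def stateProcess (N : Noise P Λ i) (c : Coefficients n m d D) (T : ℝ≥0) (ξ : Ω → Vec n)
    (u : ℝ≥0 → Ω → Vec m) (v : ℝ≥0 → Ω → Vec d) : ℝ≥0 → Ω → Vec n :=
  if h : ∃ x, IsStateProcess N c T ξ u v x then h.choose else 0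

/-- The running cost of the soft-constrained functional, with weight `R₂ - γ² I` on `v`. -/
def runningCost (c : Coefficients n m d D) (γ : ℝ) (s : ℝ≥0) (j : Fin D)
    (x : Vec n) (u : Vec m) (v : Vec d) : ℝ :=
  inner ℝ ((c.Q s j).toEuclideanLin x) x + inner ℝ ((c.R₁ s j).toEuclideanLin u) u
    + inner ℝ ((c.R₂ s j - γ ^ 2 • 1).toEuclideanLin v) v
    + 2 * inner ℝ ((c.S₁ s j).toEuclideanLin x) u + 2 * inner ℝ ((c.S₂ s j).toEuclideanLin x) v
    + 2 * inner ℝ (c.q s j) x + 2 * inner ℝ (c.ρ₁ s j) u + 2 * inner ℝ (c.ρ₂ s j) v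

/-- The terminal cost. -/
def terminalCost (c : Coefficients n m d D) (j : Fin D) (x : Vec n) : ℝ :=
  inner ℝ ((c.G j).toEuclideanLin x) x + 2 * inner ℝ (c.g j) x

/-- The soft-constrained cost functional `J_γ(0, ξ, i; u, v)`. -/
def cost (N : Noise P Λ i) (c : Coefficients n m d D) (T : ℝ≥0) (γ : ℝ) (ξ : Ω → Vec n)
    (u : ℝ≥0 → Ω → Vec m) (v : ℝ≥0 → Ω → Vec d) : ℝ :=
  ∫ ω, (terminalCost c (N.α T ω) (stateProcess N c T ξ u v T ω)
    + ∫ s, runningCost c γ s (N.α s ω) (stateProcess N c T ξ u v s ω) (u s ω) (v s ω)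
        ∂(lebesgue T)) ∂P

/-- The open-loop upper value of the soft-constrained game at initial time `0`,
`inf_{u ∈ L²_𝔾(0,T;ℝᵐ)} sup_{v ∈ L²_𝔽(0,T;ℝᵈ)} J_γ(0, ξ, i; u, v)`, an extended real number. -/
def upperValue (N : Noise P Λ i) (c : Coefficients n m d D) (T : ℝ≥0) (γ : ℝ)
    (ξ : Ω → Vec n) : EReal :=
  ⨅ u ∈ L2Prog N.partialInfo P T m, ⨆ v ∈ L2Prog N.fullInfo P T d,
    (cost N c T γ ξ u v : EReal)

/-- The open-loop upper value of the homogeneous soft-constrained game. -/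
def homogeneousUpperValue (N : Noise P Λ i) (c : Coefficients n m d D) (T : ℝ≥0) (γ : ℝ)
    (ξ : Ω → Vec n) : EReal :=
  upperValue N c.homogeneous T γ ξ

end Game

end SLQGame

end

/-!
For fixed controls `u` and `v` the state process does not involve `γ`, and `γ` enters the cost only
through the term `-γ² |v|²` of the running cost. Hence the running cost at `γ₂` is pointwise at most
the one at `γ₁` (`runningCost_anti`). The inequality passes to the expected costs
(`cost_homogeneous_anti`), and then to the infimum over `u` of the supremum over `v`, since the
admissible classes do not depend on `γ` either.

Passing to expectations requires all integrals to be finite, and this is where the work lies: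
`integrable_runningCost_homogeneous` shows that the running cost is integrable over
`[0, T] × Ω`, and `integrable_terminalCost_homogeneous` does the same for the terminal cost. They
rest on
* the joint measurability of the Markov chain in time and chance, which follows from the
  right-continuity of its paths (`IsMarkovChain.aemeasurable_uncurry`);
* the bound `E sup |x|² < ∞` for the state, which makes `⟨Q x, x⟩` integrable for `Q ∈ L¹` and `S x`
  square integrable for `S ∈ L²` (`IsSqIntegrableContinuous.integrable_inner_coeff_apply`,
  `IsSqIntegrableContinuous.memLp_coeff_apply`);
* Hölder's inequality for the terms with coefficients in `L^∞` (`IsMarkovChain.memLp_coeff_apply`).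
-/

namespace SLQGame

/-! ### Joint measurability in time and chance -/

instance isFiniteMeasure_lebesgue (t : ℝ≥0) : IsFiniteMeasure (lebesgue t) := by
  unfold lebesgue; infer_instance

theorem ae_le_lebesgue (t : ℝ≥0) : ∀ᵐ s ∂(lebesgue t), s ≤ t := by
  unfold lebesgue
  rw [ae_map_iff measurable_real_toNNReal.aemeasurable measurableSet_Iic]
  filter_upwards [ae_restrict_mem measurableSet_Icc] with s hs
  exact Real.toNNReal_le_iff_le_coe.2 hs.2

section Measurability

variable {Ω : Type*} [mΩ : MeasurableSpace Ω] {D : ℕ} {P : Measure Ω}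
  {Λ : Matrix (Fin D) (Fin D) ℝ} {i : Fin D}

theorem ae_prod_le_lebesgue [SFinite P] (T : ℝ≥0) :
    ∀ᵐ p ∂((lebesgue T).prod P), p.1 ≤ T :=
  Measure.quasiMeasurePreserving_fst.ae (ae_le_lebesgue T)

/-- The chain is jointly measurable in time and chance, up to a null set. Its paths are a.s.
right-continuous, so `α(s)` is the limit of `α` evaluated at the next point after `s` of ever finer
grids. -/
theorem IsMarkovChain.aemeasurable_uncurry {α : ℝ≥0 → Ω → Fin D} (h : IsMarkovChain P Λ i α)
    (μ : Measure ℝ≥0) [SFinite μ] [SFinite P] :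
    AEMeasurable (fun p : ℝ≥0 × Ω => α p.1 p.2) (μ.prod P) := by
  -- `τ n s` is the first point of the grid of mesh `1 / (n + 1)` that lies strictly after `s`.
  let τ : ℕ → ℝ≥0 → ℝ≥0 := fun n s => (⌊((n : ℝ≥0) + 1) * s⌋₊ + 1) / ((n : ℝ≥0) + 1)
  have hτ_ge : ∀ n s, s ≤ τ n s := fun n s => by
    rw [le_div_iff₀ (by positivity), mul_comm]
    exact (Nat.lt_floor_add_one _).le
  have hτ_le : ∀ n s, τ n s ≤ s + 1 / ((n : ℝ≥0) + 1) := fun n s => by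
    have hn : (n : ℝ≥0) + 1 ≠ 0 := by positivity
    rw [div_le_iff₀ (by positivity), add_mul s, one_div, inv_mul_cancel₀ hn, mul_comm s]
    gcongr
    exact Nat.floor_le (by positivity)
  have hτ_lim : ∀ s, Tendsto (fun n => τ n s) atTop (𝓝 s) := fun s => by
    refine tendsto_of_tendsto_of_tendsto_of_le_of_le tendsto_const_nhds ?_
      (fun n => hτ_ge n s) (fun n => hτ_le n s)
    simpa using (tendsto_const_nhds (x := s)).add
      (tendsto_one_div_add_atTop_nhds_zero_nat (𝕜 := ℝ≥0))
  refine aemeasurable_of_tendsto_metrizable_ae' (f := fun n p => α (τ n p.1) p.2) (fun n => ?_) ?_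
  · have h₁ : Measurable fun q : ℕ × Ω => α ((q.1 + 1) / ((n : ℝ≥0) + 1)) q.2 :=
      measurable_from_prod_countable_right fun k =>
        h.measurable (((k : ℝ≥0) + 1) / ((n : ℝ≥0) + 1))
    have h₂ : Measurable fun p : ℝ≥0 × Ω => (⌊((n : ℝ≥0) + 1) * p.1⌋₊, p.2) :=
      (Nat.measurable_floor.comp (measurable_fst.const_mul _)).prodMk measurable_snd
    exact (h₁.comp h₂).aemeasurable
  · filter_upwards [Measure.quasiMeasurePreserving_snd.ae h.cadlag] with p hp
    exact (hp p.1).1.tendsto.comp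
      (tendsto_nhdsWithin_iff.2 ⟨hτ_lim p.1, .of_forall fun n => hτ_ge n p.1⟩)

/-- A family of measurable functions indexed by a finite set may be evaluated at a measurable
index. -/
theorem aestronglyMeasurable_comp_fin {X E : Type*} [MeasurableSpace X] {ν : Measure X}
    [NormedAddCommGroup E] {a : X → Fin D} (ha : AEMeasurable a ν) {f : X → Fin D → E}
    (hf : ∀ j, AEStronglyMeasurable (fun p => f p j) ν) :
    AEStronglyMeasurable (fun p => f p (a p)) ν := by
  have : (fun p => f p (a p)) = fun p => ∑ j, (a ⁻¹' {j}).indicator (fun p => f p j) p := by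
    funext p
    rw [Finset.sum_eq_single (a p)] <;> simp +contextual [Set.indicator, eq_comm]
  rw [this]
  exact Finset.aestronglyMeasurable_fun_sum _ fun j _ =>
    (hf j).indicator₀ (ha.nullMeasurable (measurableSet_singleton j))

/-- A regime-dependent coefficient that is of class `L^p` in every regime is dominated, uniformly in
the regime, by an `L^p` function of time. -/
theorem exists_memLp_bound {X E : Type*} [MeasurableSpace X] {ν : Measure X}
    [NormedAddCommGroup E] {r : ℝ≥0∞} {f : X → Fin D → E} (hf : ∀ j, MemLp (fun s => f s j) r ν) :
    ∃ k : X → ℝ, MemLp k r ν ∧ ∀ s j, ‖f s j‖ ≤ k s :=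
  ⟨fun s => ∑ j, ‖f s j‖, memLp_finsetSum _ fun j _ => (hf j).norm, fun s j =>
    Finset.single_le_sum (f := fun j => ‖f s j‖) (fun _ _ => norm_nonneg _) (Finset.mem_univ j)⟩

theorem IsMarkovChain.aestronglyMeasurable_coeff {α : ℝ≥0 → Ω → Fin D} (h : IsMarkovChain P Λ i α)
    {μ : Measure ℝ≥0} [SFinite μ] [SFinite P] {E : Type*} [NormedAddCommGroup E]
    {f : ℝ≥0 → Fin D → E} (hf : ∀ j, AEStronglyMeasurable (fun s => f s j) μ) :
    AEStronglyMeasurable (fun p : ℝ≥0 × Ω => f p.1 (α p.1 p.2)) (μ.prod P) :=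
  aestronglyMeasurable_comp_fin (f := fun p j => f p.1 j) (h.aemeasurable_uncurry μ)
    fun j => (hf j).comp_fst

/-- The iterated integral in the definition of `L2Prog` is an integral over `[0, T] × Ω`, as
progressive measurability up to time `T` gives joint measurability on `[0, T]`. -/
theorem L2Prog.memLp [SFinite P] {𝓕 : Filtration ℝ≥0 mΩ} {T : ℝ≥0} {k : ℕ} {φ : ℝ≥0 → Ω → Vec k}
    (h : φ ∈ L2Prog 𝓕 P T k) :
    MemLp (fun p : ℝ≥0 × Ω => φ p.1 p.2) 2 ((lebesgue T).prod P) := by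
  have hmeas : AEStronglyMeasurable (fun p : ℝ≥0 × Ω => φ p.1 p.2) ((lebesgue T).prod P) := by
    have h₁ : StronglyMeasurable fun p : Set.Iic T × Ω => φ p.1 p.2 :=
      (h.1 T).mono (sup_le_sup le_rfl (MeasurableSpace.comap_mono (𝓕.le T)))
    have h₂ : Measurable fun p : ℝ≥0 × Ω =>
        ((⟨min p.1 T, Set.mem_Iic.2 (min_le_right _ _)⟩ : Set.Iic T), p.2) :=
      ((measurable_fst.min measurable_const).subtype_mk).prodMk measurable_snd
    refine ⟨_, h₁.comp_measurable h₂, ?_⟩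
    filter_upwards [ae_prod_le_lebesgue T] with p hp
    simp [min_eq_left hp]
  refine ⟨hmeas, ?_⟩
  rw [eLpNorm_lt_top_iff_lintegral_rpow_enorm_lt_top (by simp) (by simp)]
  simp only [ENNReal.toReal_ofNat, ENNReal.rpow_ofNat]
  rw [lintegral_prod_symm _ (hmeas.enorm.pow_const 2)]
  exact h.2

end Measurability

/-! ### Processes with square integrable supremum -/

section State

variable {Ω : Type*} [mΩ : MeasurableSpace Ω] {P : Measure Ω}

/-- The space `L²_𝓕(Ω; C([0, T]; ℝᵏ))`: adapted processes with continuous paths and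
`E sup_{s ≤ T} |x(s)|² < ∞`. -/
structure IsSqIntegrableContinuous (𝓕 : Filtration ℝ≥0 mΩ) (P : Measure Ω) (T : ℝ≥0) {k : ℕ}
    (x : ℝ≥0 → Ω → Vec k) : Prop where
  adapted : StronglyAdapted 𝓕 x
  continuous : ∀ ω, Continuous fun t => x t ω
  sq_integrable : ∫⁻ ω, ⨆ s ∈ Set.Iic T, ‖x s ω‖ₑ ^ 2 ∂P < ∞

/-- The state process lies in `L²_𝔽(Ω; C([0, T]; ℝⁿ))`. Only this regularity of the state enters the
comparison of costs: neither the state equation itself nor the uniqueness of its solution does. The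
process `0`, which stands in where there is no solution, has it as well, so that existence need not
be known. -/
theorem isSqIntegrableContinuous_stateProcess {n m d D : ℕ} {Λ : Matrix (Fin D) (Fin D) ℝ}
    {i : Fin D} (N : Noise P Λ i) (c : Coefficients n m d D) (T : ℝ≥0) (ξ : Ω → Vec n)
    (u : ℝ≥0 → Ω → Vec m) (v : ℝ≥0 → Ω → Vec d) :
    IsSqIntegrableContinuous N.fullInfo P T (stateProcess N c T ξ u v) := by
  unfold stateProcess
  split_ifs with h
  · exact ⟨h.choose_spec.adapted, h.choose_spec.continuous, h.choose_spec.sq_integrable⟩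
  · exact ⟨fun t => stronglyMeasurable_const, fun ω => continuous_const, by simp⟩

namespace IsSqIntegrableContinuous

variable {𝓕 : Filtration ℝ≥0 mΩ} {T : ℝ≥0} {k : ℕ} {x : ℝ≥0 → Ω → Vec k}

theorem stronglyMeasurable (h : IsSqIntegrableContinuous 𝓕 P T x) (t : ℝ≥0) :
    StronglyMeasurable (x t) :=
  (h.adapted t).mono (𝓕.le t)

theorem stronglyMeasurable_uncurry (h : IsSqIntegrableContinuous 𝓕 P T x) :
    StronglyMeasurable fun p : ℝ≥0 × Ω => x p.1 p.2 :=
  stronglyMeasurable_uncurry_of_continuous_of_stronglyMeasurable h.continuous h.stronglyMeasurable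

/-- The running supremum of `|x|²` is a.s. bounded by an integrable random variable; by continuity
of the paths the supremum over a countable dense set of times will do. -/
theorem exists_integrable_bound (h : IsSqIntegrableContinuous 𝓕 P T x) :
    ∃ M : Ω → ℝ, Integrable M P ∧ ∀ᵐ ω ∂P, ∀ s ≤ T, ‖x s ω‖ ^ 2 ≤ M ω := by
  let F : Ω → ℝ≥0∞ := fun ω =>
    ⨆ l : ℕ, ‖x (min (TopologicalSpace.denseSeq ℝ≥0 l) T) ω‖ₑ ^ 2
  have hFm : Measurable F :=
    .iSup fun l => (h.stronglyMeasurable _).measurable.enorm.pow_const 2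
  have hF : ∫⁻ ω, F ω ∂P ≠ ∞ := by
    refine (lt_of_le_of_lt (lintegral_mono fun ω => iSup_le fun l => ?_) h.sq_integrable).ne
    exact le_iSup₂_of_le (f := fun s (_ : s ∈ Set.Iic T) => ‖x s ω‖ₑ ^ 2) _
      (Set.mem_Iic.2 (min_le_right _ _)) le_rfl
  have hsup : ∀ ω s, s ≤ T → ‖x s ω‖ₑ ^ 2 ≤ F ω := fun ω s hs => by
    have hcl : IsClosed {s : ℝ≥0 | ‖x (min s T) ω‖ₑ ^ 2 ≤ F ω} := by
      refine isClosed_le (ENNReal.continuous_pow 2 |>.comp ?_) continuous_const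
      exact ((h.continuous ω).comp (continuous_id.min continuous_const)).enorm
    have hd : s ∈ closure (Set.range (TopologicalSpace.denseSeq ℝ≥0)) :=
      TopologicalSpace.denseRange_denseSeq ℝ≥0 s
    have := closure_minimal (t := {s : ℝ≥0 | ‖x (min s T) ω‖ₑ ^ 2 ≤ F ω})
      (by rintro _ ⟨l, rfl⟩; exact le_iSup (fun l =>
        ‖x (min (TopologicalSpace.denseSeq ℝ≥0 l) T) ω‖ₑ ^ 2) l) hcl hd
    simpa [min_eq_left hs] using this
  refine ⟨fun ω => (F ω).toReal, integrable_toReal_of_lintegral_ne_top hFm.aemeasurable hF, ?_⟩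
  filter_upwards [ae_lt_top hFm hF] with ω hω s hs
  have := ENNReal.toReal_mono hω.ne (hsup ω s hs)
  simpa using this

end IsSqIntegrableContinuous

end State

/-! ### Integrability of the cost and its monotonicity in `γ` -/

section Cost

variable {Ω : Type*} [mΩ : MeasurableSpace Ω] {D : ℕ} {P : Measure Ω}
  {Λ : Matrix (Fin D) (Fin D) ℝ} {i : Fin D} {T : ℝ≥0} {a b : ℕ}

/-- The continuous linear map between Euclidean spaces given by a matrix. -/
noncomputable def euclideanCLM (M : Matrix (Fin b) (Fin a) ℝ) : Vec a →L[ℝ] Vec b :=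
  M.toEuclideanLin.toContinuousLinearMap

open scoped Matrix.Norms.Frobenius in
theorem memLp_euclideanCLM {X : Type*} [MeasurableSpace X] {ν : Measure X} {r : ℝ≥0∞}
    {M : X → Matrix (Fin b) (Fin a) ℝ} (hM : MemLp M r ν) :
    MemLp (fun s => euclideanCLM (M s)) r ν :=
  (LinearMap.toContinuousLinearMap (Matrix.toEuclideanLin (𝕜 := ℝ) (m := Fin b) (n := Fin a) ≪≫ₗ
    LinearMap.toContinuousLinearMap).toLinearMap).comp_memLp' hM

theorem integrable_inner_of_memLp {X E : Type*} [MeasurableSpace X] {ν : Measure X}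
    [NormedAddCommGroup E] [InnerProductSpace ℝ E] {f g : X → E} (hf : MemLp f 2 ν)
    (hg : MemLp g 2 ν) : Integrable (fun p => inner ℝ (f p) (g p)) ν :=
  memLp_one_iff_integrable.1 <| hf.of_bilin (fun y z => inner ℝ y z) 1 hg (hf.1.inner hg.1)
    (.of_forall fun p => by simpa using nnnorm_inner_le_nnnorm (𝕜 := ℝ) (f p) (g p))

/-- An `L^∞` coefficient maps square integrable processes to square integrable processes. -/
theorem IsMarkovChain.memLp_coeff_apply [IsFiniteMeasure P] {α : ℝ≥0 → Ω → Fin D}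
    (h : IsMarkovChain P Λ i α) {K : ℝ≥0 → Fin D → Vec a →L[ℝ] Vec b}
    (hK : ∀ j, MemLp (fun s => K s j) ∞ (lebesgue T)) {φ : ℝ≥0 → Ω → Vec a}
    (hφ : MemLp (fun p : ℝ≥0 × Ω => φ p.1 p.2) 2 ((lebesgue T).prod P)) :
    MemLp (fun p : ℝ≥0 × Ω => K p.1 (α p.1 p.2) (φ p.1 p.2)) 2 ((lebesgue T).prod P) := by
  obtain ⟨k, hk, hkb⟩ := exists_memLp_bound hK
  have hm := h.aestronglyMeasurable_coeff (P := P) (fun j => (hK j).1)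
  have hK' : MemLp (fun p : ℝ≥0 × Ω => K p.1 (α p.1 p.2)) ∞ ((lebesgue T).prod P) :=
    (hk.comp_fst P).mono hm (.of_forall fun p => (hkb _ _).trans (le_abs_self _))
  exact hK'.of_bilin (r := 2) (fun L y => L y) 1 hφ
    (isBoundedBilinearMap_apply.continuous.comp_aestronglyMeasurable₂ hm hφ.1)
    (.of_forall fun p => by simpa using (K p.1 (α p.1 p.2)).le_opNNNorm (φ p.1 p.2))

/-- An `L²` coefficient maps a process with square integrable supremum to a square integrable
process. -/
theorem IsSqIntegrableContinuous.memLp_coeff_apply [IsFiniteMeasure P] {α : ℝ≥0 → Ω → Fin D}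
    (h : IsMarkovChain P Λ i α) {𝓕 : Filtration ℝ≥0 mΩ} {x : ℝ≥0 → Ω → Vec a}
    (hx : IsSqIntegrableContinuous 𝓕 P T x) {K : ℝ≥0 → Fin D → Vec a →L[ℝ] Vec b}
    (hK : ∀ j, MemLp (fun s => K s j) 2 (lebesgue T)) :
    MemLp (fun p : ℝ≥0 × Ω => K p.1 (α p.1 p.2) (x p.1 p.2)) 2 ((lebesgue T).prod P) := by
  obtain ⟨k, hk, hkb⟩ := exists_memLp_bound hK
  obtain ⟨M, hM, hMb⟩ := hx.exists_integrable_bound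
  have hm : AEStronglyMeasurable (fun p : ℝ≥0 × Ω => K p.1 (α p.1 p.2) (x p.1 p.2))
      ((lebesgue T).prod P) :=
    isBoundedBilinearMap_apply.continuous.comp_aestronglyMeasurable₂
      (h.aestronglyMeasurable_coeff fun j => (hK j).1)
      hx.stronglyMeasurable_uncurry.aestronglyMeasurable
  rw [memLp_two_iff_integrable_sq_norm hm]
  refine (hk.integrable_sq.mul_prod hM).mono' (hm.norm.pow 2) ?_
  filter_upwards [ae_prod_le_lebesgue T, Measure.quasiMeasurePreserving_snd.ae hMb] with p hp hpM
  rw [Real.norm_of_nonneg (by positivity)]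
  calc ‖K p.1 (α p.1 p.2) (x p.1 p.2)‖ ^ 2
      ≤ (‖K p.1 (α p.1 p.2)‖ * ‖x p.1 p.2‖) ^ 2 := by gcongr; exact ContinuousLinearMap.le_opNorm _ _
    _ = ‖K p.1 (α p.1 p.2)‖ ^ 2 * ‖x p.1 p.2‖ ^ 2 := mul_pow _ _ _
    _ ≤ k p.1 ^ 2 * M p.2 := by
      gcongr
      · exact hkb _ _
      · exact hpM _ hp

/-- An `L¹` coefficient gives an integrable quadratic form along a process with square integrable
supremum. -/
theorem IsSqIntegrableContinuous.integrable_inner_coeff_apply [IsFiniteMeasure P]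
    {α : ℝ≥0 → Ω → Fin D} (h : IsMarkovChain P Λ i α) {𝓕 : Filtration ℝ≥0 mΩ}
    {x : ℝ≥0 → Ω → Vec a} (hx : IsSqIntegrableContinuous 𝓕 P T x)
    {K : ℝ≥0 → Fin D → Vec a →L[ℝ] Vec a} (hK : ∀ j, MemLp (fun s => K s j) 1 (lebesgue T)) :
    Integrable (fun p : ℝ≥0 × Ω => inner ℝ (K p.1 (α p.1 p.2) (x p.1 p.2)) (x p.1 p.2))
      ((lebesgue T).prod P) := by
  obtain ⟨k, hk, hkb⟩ := exists_memLp_bound hK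
  obtain ⟨M, hM, hMb⟩ := hx.exists_integrable_bound
  have hxm := hx.stronglyMeasurable_uncurry.aestronglyMeasurable (μ := (lebesgue T).prod P)
  have hm : AEStronglyMeasurable (fun p : ℝ≥0 × Ω => K p.1 (α p.1 p.2) (x p.1 p.2))
      ((lebesgue T).prod P) :=
    isBoundedBilinearMap_apply.continuous.comp_aestronglyMeasurable₂
      (h.aestronglyMeasurable_coeff fun j => (hK j).1) hxm
  refine ((memLp_one_iff_integrable.1 hk).mul_prod hM).mono' (hm.inner hxm) ?_
  filter_upwards [ae_prod_le_lebesgue T, Measure.quasiMeasurePreserving_snd.ae hMb] with p hp hpM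
  calc ‖inner ℝ (K p.1 (α p.1 p.2) (x p.1 p.2)) (x p.1 p.2)‖
      ≤ ‖K p.1 (α p.1 p.2) (x p.1 p.2)‖ * ‖x p.1 p.2‖ := norm_inner_le_norm _ _
    _ ≤ ‖K p.1 (α p.1 p.2)‖ * ‖x p.1 p.2‖ * ‖x p.1 p.2‖ := by
      gcongr; exact ContinuousLinearMap.le_opNorm _ _
    _ = ‖K p.1 (α p.1 p.2)‖ * ‖x p.1 p.2‖ ^ 2 := by ring
    _ ≤ k p.1 * M p.2 := by
      gcongr
      · exact (norm_nonneg _).trans (hkb _ (α p.1 p.2))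
      · exact hkb _ _
      · exact hpM _ hp

variable {n m d : ℕ}

open scoped Matrix.Norms.Frobenius in
theorem integrable_runningCost_homogeneous [IsFiniteMeasure P] (N : Noise P Λ i)
    {c : Coefficients n m d D} (hc : c.H2 T) (γ : ℝ) {𝓕 𝓖 𝓗 : Filtration ℝ≥0 mΩ}
    {x : ℝ≥0 → Ω → Vec n} (hx : IsSqIntegrableContinuous 𝓕 P T x)
    {u : ℝ≥0 → Ω → Vec m} (hu : u ∈ L2Prog 𝓖 P T m)
    {v : ℝ≥0 → Ω → Vec d} (hv : v ∈ L2Prog 𝓗 P T d) :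
    Integrable (fun p : ℝ≥0 × Ω =>
      runningCost c.homogeneous γ p.1 (N.α p.1 p.2) (x p.1 p.2) (u p.1 p.2) (v p.1 p.2))
      ((lebesgue T).prod P) := by
  have hu' := L2Prog.memLp hu
  have hv' := L2Prog.memLp hv
  have hQ := hx.integrable_inner_coeff_apply N.chain fun j => memLp_euclideanCLM (hc.Q j)
  have hR₁ := integrable_inner_of_memLp
    (N.chain.memLp_coeff_apply (fun j => memLp_euclideanCLM (hc.R₁ j)) hu') hu'
  have hR₂ := integrable_inner_of_memLp
    (N.chain.memLp_coeff_apply (fun j => memLp_euclideanCLM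
      ((hc.R₂ j).sub (memLp_top_const (γ ^ 2 • (1 : Matrix (Fin d) (Fin d) ℝ))))) hv') hv'
  have hS₁ := integrable_inner_of_memLp
    (hx.memLp_coeff_apply N.chain fun j => memLp_euclideanCLM (hc.S₁ j)) hu'
  have hS₂ := integrable_inner_of_memLp
    (hx.memLp_coeff_apply N.chain fun j => memLp_euclideanCLM (hc.S₂ j)) hv'
  refine ((((hQ.add hR₁).add hR₂).add (hS₁.const_mul 2)).add (hS₂.const_mul 2)).congr
    (.of_forall fun p => ?_)
  simp [runningCost, Coefficients.homogeneous, euclideanCLM]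

theorem integrable_terminalCost_homogeneous [IsFiniteMeasure P] (N : Noise P Λ i)
    (c : Coefficients n m d D) {𝓕 : Filtration ℝ≥0 mΩ}
    {x : ℝ≥0 → Ω → Vec n} (hx : IsSqIntegrableContinuous 𝓕 P T x) :
    Integrable (fun ω => terminalCost c.homogeneous (N.α T ω) (x T ω)) P := by
  obtain ⟨M, hM, hMb⟩ := hx.exists_integrable_bound
  have hxm := (hx.stronglyMeasurable T).aestronglyMeasurable (μ := P)
  have hm : AEStronglyMeasurable (fun ω => terminalCost c.homogeneous (N.α T ω) (x T ω)) P := by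
    refine aestronglyMeasurable_comp_fin (f := fun ω j => terminalCost c.homogeneous j (x T ω))
      (N.chain.measurable T).aemeasurable fun j => ?_
    have : AEStronglyMeasurable (fun ω => inner ℝ (euclideanCLM (c.G j) (x T ω)) (x T ω)) P :=
      ((euclideanCLM (c.G j)).continuous.comp_aestronglyMeasurable hxm).inner hxm
    simpa [terminalCost, Coefficients.homogeneous, euclideanCLM] using this
  refine (hM.const_mul (∑ j, ‖euclideanCLM (c.G j)‖)).mono' hm ?_
  filter_upwards [hMb] with ω hω
  have hG : terminalCost c.homogeneous (N.α T ω) (x T ω)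
      = inner ℝ (euclideanCLM (c.G (N.α T ω)) (x T ω)) (x T ω) := by
    simp [terminalCost, Coefficients.homogeneous, euclideanCLM]
  rw [hG]
  calc ‖inner ℝ (euclideanCLM (c.G (N.α T ω)) (x T ω)) (x T ω)‖
      ≤ ‖euclideanCLM (c.G (N.α T ω)) (x T ω)‖ * ‖x T ω‖ := norm_inner_le_norm _ _
    _ ≤ ‖euclideanCLM (c.G (N.α T ω))‖ * ‖x T ω‖ * ‖x T ω‖ := by
      gcongr; exact ContinuousLinearMap.le_opNorm _ _
    _ = ‖euclideanCLM (c.G (N.α T ω))‖ * ‖x T ω‖ ^ 2 := by ring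
    _ ≤ (∑ j, ‖euclideanCLM (c.G j)‖) * M ω := by
      gcongr
      · exact Finset.single_le_sum (f := fun j => ‖euclideanCLM (c.G j)‖)
          (fun _ _ => norm_nonneg _) (Finset.mem_univ _)
      · exact hω T le_rfl

theorem runningCost_anti (c : Coefficients n m d D) {γ₁ γ₂ : ℝ} (h₀ : 0 ≤ γ₁) (h : γ₁ ≤ γ₂)
    (s : ℝ≥0) (j : Fin D) (x : Vec n) (u : Vec m) (v : Vec d) :
    runningCost c γ₂ s j x u v ≤ runningCost c γ₁ s j x u v := by
  -- The weight `R₂ - γ² I` contributes `⟨R₂ v, v⟩ - γ² |v|²`.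
  have key : ∀ γ : ℝ, inner ℝ ((c.R₂ s j - γ ^ 2 • 1).toEuclideanLin v) v
      = inner ℝ ((c.R₂ s j).toEuclideanLin v) v - γ ^ 2 * ‖v‖ ^ 2 := fun γ => by
    have h1 : Matrix.toEuclideanLin (1 : Matrix (Fin d) (Fin d) ℝ) v = v := by
      ext l
      simp
    rw [map_sub, map_smul, LinearMap.sub_apply, inner_sub_left, LinearMap.smul_apply, h1,
      real_inner_smul_left, real_inner_self_eq_norm_sq]
  have : γ₁ ^ 2 * ‖v‖ ^ 2 ≤ γ₂ ^ 2 * ‖v‖ ^ 2 := by gcongr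
  simp only [runningCost, key]
  linarith

/-- For fixed controls the cost decreases in `γ`: the state does not depend on `γ`, and the running
cost decreases pointwise. All integrals involved are finite, so the inequality passes to
expectations. -/
theorem cost_homogeneous_anti [IsFiniteMeasure P] (N : Noise P Λ i) {c : Coefficients n m d D}
    (hc : c.H2 T) {γ₁ γ₂ : ℝ} (h₀ : 0 ≤ γ₁) (h : γ₁ ≤ γ₂) (ξ : Ω → Vec n)
    {𝓖 𝓗 : Filtration ℝ≥0 mΩ} {u : ℝ≥0 → Ω → Vec m} (hu : u ∈ L2Prog 𝓖 P T m)
    {v : ℝ≥0 → Ω → Vec d} (hv : v ∈ L2Prog 𝓗 P T d) :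
    cost N c.homogeneous T γ₂ ξ u v ≤ cost N c.homogeneous T γ₁ ξ u v := by
  have hx := isSqIntegrableContinuous_stateProcess N c.homogeneous T ξ u v
  have hT := integrable_terminalCost_homogeneous N c hx
  have hr := fun γ => integrable_runningCost_homogeneous N hc γ hx hu hv
  refine integral_mono_ae (hT.add (hr γ₂).integral_prod_right)
    (hT.add (hr γ₁).integral_prod_right) ?_
  filter_upwards [(hr γ₂).prod_left_ae, (hr γ₁).prod_left_ae] with ω h₂ h₁
  exact add_le_add le_rfl (integral_mono h₂ h₁ fun s => runningCost_anti _ h₀ h _ _ _ _ _)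

end Cost

end SLQGame

theorem proposition3p1 {Ω : Type*} [MeasurableSpace Ω] (P : Measure Ω) [IsProbabilityMeasure P]
    [P.IsComplete] {n m d D : ℕ} (Λ : Matrix (Fin D) (Fin D) ℝ) (i : Fin D) (N : SLQGame.Noise P Λ i)
    (T : ℝ≥0) (hT : 0 < T) (c : SLQGame.Coefficients n m d D)
    (h1 : c.H1 T) (h2 : c.H2 T) (h3 : c.H3 T)
    (γ₁ γ₂ : ℝ) (hγ₁ : 0 < γ₁) (hγ : γ₁ ≤ γ₂) :
    SLQGame.homogeneousUpperValue N c T γ₂ 0 ≤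
      SLQGame.homogeneousUpperValue N c T γ₁ 0 :=
  iInf₂_mono fun _ hu => iSup₂_mono fun _ hv =>
    EReal.coe_le_coe_iff.2 (SLQGame.cost_homogeneous_anti N h2 hγ₁.le hγ 0 hu hv)
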